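/- **Setting.** A UAV moves on a finite set $C\subset\mathbb Z^2$ of grid cells in a static environment. There are eight actions (the directions $d_0,\dots,d_7\in\{-1,0,1\}^2\setminus\{0\}$, separated by $45^\circ$); action $a$ moves the UAV from $x$ to $x+v\,d_a$, where $v\ge 1$ is an integer speed. The action is *possible* at $x$ if $x+vd_a\in C$ and the move does not lead to a crash (an arbitrary crash relation on $C\times\{\text{actions}\}$ is given). Each cell $x$ has a received signal strength $\mathrm{RSS}(x)\in\mathbb R$, and different cells have different RSS. The states of the Markov decision process are the RSS values of the cells; a state is *terminal* if its RSS exceeds a given threshold $\theta$ (the source is found, and the episode ends). Every non-terminal state has at least one possible action; write $A(s)$ for the possible actions in $s$, and $s'=s\cdot a$ for the state reached from $s$ by $a$. The reward is $r(s,a)=\mathrm{RSS}(s')-\mathrm{RSS}(s)$ if $s'$ is not terminal, and a constant $D\in\mathbb R$ (the reward for detecting the source) if $s'$ is terminal. The discount factor is $\gamma\in[0,1)$. The optimal action-value function is $Q^*(s,a)=\max_\pi Q^\pi(s,a)$, where $\pi$ runs over the policies choosing a possible action in each non-terminal state and $Q^\pi(s,a)$ is the total discounted reward, up to the end of the episode,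 of taking $a$ in $s$ and following $\pi$ afterwards. **Algorithm.** Parameters: $\alpha_{\max}\in(0,1]$, $\alpha_{\min}>0$, $\varepsilon_{\max}\in(0,1]$, $\varepsilon_{\min}>0$, $\eta\ge 0$; start with $\alpha=\alpha_{\max}$, $\varepsilon=\varepsilon_{\max}$, an arbitrary initial table $Q_0$, and a random initial state drawn from a distribution $\mu$ on the non-terminal states. In each step: if $\varepsilon\ge\varepsilon_{\min}$, replace $\varepsilon$ by $\varepsilon e^{-\eta}$; if $\alpha\ge\alpha_{\min}$, replace $\alpha$ by $\alpha e^{-\eta}$; draw $u$ uniformly from $[0,1]$; if $u<\varepsilon$ draw a uniformly random action, otherwise take an action with the highest value $Q(s,\cdot)$ (ties broken by any fixed rule); as long as the action is not possible, drop it and draw another one at random; perform the resulting action $a$, observe $s'$, and update $$Q(s,a)\leftarrow(1-\alpha)Q(s,a)+\alpha\bigl[r(s,a)+\gamma\max_{a'\in A(s')}Q(s',a')\bigr],$$ where the maximum is read as $0$ if $s'$ is terminal. Then $s\leftarrow s'$; if $s'$ is terminal, a new episode starts from a state drawn from $\mu$ (keeping $Q,\alpha,\varepsilon$). All random draws are independent.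 Let $Q_t$ be the table after $t$ steps. A *visitable* state is one that can be reached from the support of $\mu$ by possible moves from non-terminal states; an *entry* is a pair $(s,a)$ with $s$ visitable and non-terminal and $a\in A(s)$. **Statement.** 1. With probability one, if every entry is updated infinitely often, then $Q_t(s,a)\to Q^*(s,a)$ for every entry $(s,a)$. 2. If from every visitable state some terminal state can be reached by possible moves, then with probability one every entry is updated infinitely often and $Q_t(s,a)\to Q^*(s,a)$ for every entry $(s,a)$. -/

import Mathlib

open MeasureTheory ProbabilityTheory Filter Topology

noncomputable section

namespace RSSNav

/-- Centres of the one-metre grid cells. -/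
abbrev Cell := ℤ × ℤ

/-- The eight flight directions, separated by 45 degrees. -/
abbrev Action := Fin 8

/-- Unit displacement on the grid in each of the eight directions. -/
def dir : Action → Cell :=
  ![(1, 0), (1, 1), (0, 1), (-1, 1), (-1, 0), (-1, -1), (0, -1), (1, -1)]

/-- A static indoor environment of finite area with a fixed source. -/
structure Environment where
  /-- the grid cells in which the UAV may be -/
  cells : Finset Cell
  /-- number of cells traversed per time step (the UAV speed) -/
  stride : ℕ
  stride_pos : 0 < stride
  /-- `crash x a`: flying from `x` in direction `a` leads to a collision -/
  crash : Cell → Action → Prop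
  /-- received signal strength at a cell -/
  rss : Cell → ℝ
  /-- no two cells have the same received signal strength -/
  rss_injOn : Set.InjOn rss (cells : Set Cell)
  /-- an episode ends when the received signal strength exceeds this threshold -/
  threshold : ℝ
  /-- reward for detecting the source -/
  goalReward : ℝ
  /-- at every cell where an episode is not over, some direction is collision-free -/
  exists_move : ∀ x ∈ cells, rss x ≤ threshold →
    ∃ a : Action, x + stride • dir a ∈ cells ∧ ¬ crash x a

namespace Environment

variable (E : Environment)

/-- The states are the received signal strengths occurring on the grid. -/
def State : Type := {r : ℝ // r ∈ E.rss '' (E.cells : Set Cell)}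

instance : MeasurableSpace E.State :=
  inferInstanceAs (MeasurableSpace {r : ℝ // r ∈ E.rss '' (E.cells : Set Cell)})

/-- The (unique) grid cell with the given received signal strength. -/
def loc (s : E.State) : Cell := Classical.choose s.2

theorem loc_mem (s : E.State) : E.loc s ∈ E.cells :=
  Finset.mem_coe.1 (Classical.choose_spec s.2).1

theorem rss_loc (s : E.State) : E.rss (E.loc s) = s.1 :=
  (Classical.choose_spec s.2).2

/-- The state label assigned to a grid cell. -/
def label (x : Cell) (hx : x ∈ E.cells) : E.State :=
  ⟨E.rss x, x, Finset.mem_coe.2 hx, rfl⟩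

theorem loc_label (x : Cell) (hx : x ∈ E.cells) : E.loc (E.label x hx) = x :=
  E.rss_injOn (Finset.mem_coe.2 (E.loc_mem _)) (Finset.mem_coe.2 hx) (E.rss_loc _)

/-- The source has been found. -/
def Terminal (s : E.State) : Prop := E.threshold < s.1

open Classical in
/-- The possible (collision-free) actions in a state. -/
def allowed (s : E.State) : Finset Action :=
  Finset.univ.filter fun a => E.loc s + E.stride • dir a ∈ E.cells ∧ ¬ E.crash (E.loc s) a

theorem allowed_nonempty {s : E.State} (h : ¬ E.Terminal s) : (E.allowed s).Nonempty := by
  obtain ⟨a, ha⟩ := E.exists_move (E.loc s) (E.loc_mem s) (by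
    rw [E.rss_loc]; exact not_lt.1 h)
  exact ⟨a, by simpa [allowed] using ha⟩

open Classical in
/-- The state observed after action `a` in state `s` (only used for possible actions). -/
def next (s : E.State) (a : Action) : E.State :=
  if h : E.loc s + E.stride • dir a ∈ E.cells then E.label _ h else s

open Classical in
/-- Increase of the received signal strength, or the detection reward if the source is found. -/
def reward (s : E.State) (a : Action) : ℝ :=
  if E.Terminal (E.next s a) then E.goalReward else (E.next s a).1 - s.1

/-- One possible move inside an episode. -/
def Move (s s' : E.State) : Prop := ¬ E.Terminal s ∧ ∃ a ∈ E.allowed s, E.next s a = s'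

/-! ### The optimal action-value function -/

/-- Policies choose a possible action in every non-terminal state. -/
def Policy : Type := {π : E.State → Action // ∀ s, ¬ E.Terminal s → π s ∈ E.allowed s}

open Classical in
/-- State after `n` steps under a policy; terminal states end the episode. -/
def follow (π : E.Policy) (s : E.State) : ℕ → E.State
  | 0 => s
  | n + 1 => if E.Terminal (follow π s n) then follow π s n
      else E.next (follow π s n) (π.1 (follow π s n))

open Classical in
/-- Total discounted reward collected by a policy from `s` until the end of the episode. -/
def policyValue (γ : ℝ) (π : E.Policy) (s : E.State) : ℝ :=
  ∑' n : ℕ, γ ^ n * (if E.Terminal (E.follow π s n) then 0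
    else E.reward (E.follow π s n) (π.1 (E.follow π s n)))

/-- Total discounted reward of taking `a` in `s` and following `π` afterwards. -/
def policyActionValue (γ : ℝ) (π : E.Policy) (s : E.State) (a : Action) : ℝ :=
  E.reward s a + γ * E.policyValue γ π (E.next s a)

/-- The optimal action-value function: the best value over all (finitely many) policies. -/
def optimalActionValue (γ : ℝ) (s : E.State) (a : Action) : ℝ :=
  ⨆ π : E.Policy, E.policyActionValue γ π s a

/-! ### The learning algorithm -/

open Classical in
/-- `max_{a'} Q(s, a')` over the possible actions, and `0` once the episode is over. -/
def maxValue (Q : E.State → Action → ℝ) (s : E.State) : ℝ :=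
  if h : E.Terminal s then 0 else (E.allowed s).sup' (E.allowed_nonempty h) (Q s)

open Classical in
/-- The Q-table after one update of the entry `(s, a)` with learning rate `α`. -/
def update (γ α : ℝ) (Q : E.State → Action → ℝ) (s : E.State) (a : Action) :
    E.State → Action → ℝ := fun s₁ a₁ =>
  if s₁ = s ∧ a₁ = a then
    (1 - α) * Q s a + α * (E.reward s a + γ * E.maxValue Q (E.next s a))
  else Q s₁ a₁

end Environment

/-- Numerical parameters of the algorithm. -/
structure Params where
  /-- discount factor -/
  γ : ℝ
  /-- initial learning rate -/
  αmax : ℝ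
  /-- the learning rate decays only while it is at least `αmin` -/
  αmin : ℝ
  /-- initial exploration parameter -/
  εmax : ℝ
  /-- the exploration parameter decays only while it is at least `εmin` -/
  εmin : ℝ
  /-- decay factor -/
  η : ℝ

/-- The admissible parameter ranges. -/
structure Params.Valid (p : Params) : Prop where
  γ_nonneg : 0 ≤ p.γ
  γ_lt_one : p.γ < 1
  αmax_pos : 0 < p.αmax
  αmax_le_one : p.αmax ≤ 1
  αmin_pos : 0 < p.αmin
  εmax_pos : 0 < p.εmax
  εmax_le_one : p.εmax ≤ 1
  εmin_pos : 0 < p.εmin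
  η_nonneg : 0 ≤ p.η

/-- Exponential decay of a rate, stopped as soon as the rate is below `lower`. -/
def decay (η lower x : ℝ) : ℝ := if lower ≤ x then x * Real.exp (-η) else x

instance : MeasurableSpace (Equiv.Perm Action) := ⊤

variable (E : Environment)

/-- The randomness used at one time step: a number in `[0,1]` compared with the exploration
parameter, a random order in which actions are drawn, and an initial state for the next
episode, in case the current one ends. -/
abbrev Noise : Type := ℝ × Equiv.Perm Action × E.State

/-- Law of the randomness of one step: independent uniform number in `[0,1]`, uniform order
of the eight actions, and initial state with law `start`. -/
def noiseLaw (start : PMF E.State) : Measure (Noise E) :=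
  (volume.restrict (Set.Icc (0 : ℝ) 1)).prod
    ((PMF.uniformOfFintype (Equiv.Perm Action)).toMeasure.prod start.toMeasure)

/-- Memory of the algorithm: current state, Q-table, learning rate, exploration parameter. -/
structure Config where
  state : E.State
  table : E.State → Action → ℝ
  α : ℝ
  ε : ℝ

variable {E}

/-- Draw actions in the random order `σ`, dropping those that lead to a crash. -/
def firstAllowed (s : E.State) (σ : Equiv.Perm Action) : Action :=
  ((List.ofFn σ).find? fun a => decide (a ∈ E.allowed s)).getD (σ 0)

/-- The action executed in configuration `c`. If `u < ε` (after decay of `ε`) the action is random,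
otherwise it is the greedy one; an action that leads to a crash is dropped and others are
drawn at random until one is possible. -/
def chosenAction (p : Params) (greedy : (Action → ℝ) → Action) (c : Config E) (w : Noise E) :
    Action :=
  if w.1 < decay p.η p.εmin c.ε then firstAllowed c.state w.2.1
  else if greedy (c.table c.state) ∈ E.allowed c.state then greedy (c.table c.state)
  else firstAllowed c.state w.2.1

open Classical in
/-- One step of the algorithm: decay the rates, act, update the table; if the source is found,
start a new episode. -/
def stepConfig (p : Params) (greedy : (Action → ℝ) → Action) (c : Config E) (w : Noise E) :
    Config E where
  state := if E.Terminal (E.next c.state (chosenAction p greedy c w)) then w.2.2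
    else E.next c.state (chosenAction p greedy c w)
  table := E.update p.γ (decay p.η p.αmin c.α) c.table c.state (chosenAction p greedy c w)
  α := decay p.η p.αmin c.α
  ε := decay p.η p.εmin c.ε

/-- The run of the algorithm driven by the noise sequence `w`, from the initial table `Q₀`. -/
def run (p : Params) (greedy : (Action → ℝ) → Action) (Q₀ : E.State → Action → ℝ)
    (w : ℕ → Noise E) : ℕ → Config E
  | 0 => ⟨(w 0).2.2, Q₀, p.αmax, p.εmax⟩
  | t + 1 => stepConfig p greedy (run p greedy Q₀ w t) (w (t + 1))

/-- The entry `(s, a)` of the table is updated in step `t`. -/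
def Updated (p : Params) (greedy : (Action → ℝ) → Action) (Q₀ : E.State → Action → ℝ)
    (w : ℕ → Noise E) (s : E.State) (a : Action) (t : ℕ) : Prop :=
  (run p greedy Q₀ w t).state = s ∧
    chosenAction p greedy (run p greedy Q₀ w t) (w (t + 1)) = a

/-- The state `s` can occur in an episode. -/
def Visitable (start : PMF E.State) (s : E.State) : Prop :=
  ∃ s₀ ∈ start.support, Relation.ReflTransGen E.Move s₀ s

/-- `(s, a)` is an entry of the table: `s` can occur and is not terminal, `a` is possible. -/
def IsEntry (start : PMF E.State) (s : E.State) (a : Action) : Prop :=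
  Visitable start s ∧ ¬ E.Terminal s ∧ a ∈ E.allowed s

end RSSNav

end

/-!
The environment is deterministic, so the argument has a pathwise part and a probabilistic part
that only concerns which entries get updated.

*Optimal values.* The Bellman operator `bellman` is a `γ`-contraction of the finite-dimensional
space of tables, so it has a fixed point `Q°`. Every policy has value at most `maxValue Q°`, and
the policy that is greedy for `Q°` attains it, since the largest gap between the two sides is
bounded by `γ` times itself. Hence `Q°` is the optimal action-value function
(`optimalActionValue_eq`), which is therefore itself a fixed point of the Bellman operator.

*Convergence.* The learning rate stays in `[α₀, 1]` for some `α₀ > 0`. If all entries have error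
at most `B` from some time on, an update of an entry replaces its error `e` by at most
`(1 - α) e + α γ B`. An entry that is updated infinitely often therefore eventually has error at
most `κ B`, where `κ = (1 + γ) / 2 < 1` (`eventually_le_of_frequently_update`). Since there are
finitely many entries, iterating shows that all errors tend to zero (`tendsto_table`). This
holds on every path of the noise along which every entry is updated infinitely often.

*Recurrence.* The exploration parameter stays above some `ε₀ > 0`. As long as `u < ε₀`, the next
state is a function of the current state, the random order of the actions and the restart state.
If the source can always be found, every state has a finite word of action orders which leads to
a restart and from there to the update of a given entry. Concatenating such words, each chosen
for the state where the preceding ones lead, gives a single word that forces this update from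
*every* admissible state (`exists_universal_word`). The word occurs in disjoint blocks of
the noise with a fixed positive probability, independently for different blocks, so by the second
Borel-Cantelli lemma it occurs infinitely often (`ae_frequently_block`), and no conditioning on
the history is needed.
-/

noncomputable section

namespace RSSNav

/-! ### The optimal action-value function -/

namespace Environment

variable {E : Environment}

instance : Finite E.State :=
  (E.cells.finite_toSet.image E.rss).to_subtype

noncomputable instance : Fintype E.State := Fintype.ofFinite _

instance : MeasurableSingletonClass E.State :=
  inferInstanceAs (MeasurableSingletonClass {r : ℝ // r ∈ E.rss '' (E.cells : Set Cell)})

theorem maxValue_of_terminal {s : E.State} (h : E.Terminal s) (Q : E.State → Action → ℝ) :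
    E.maxValue Q s = 0 := dif_pos h

theorem maxValue_of_not_terminal {s : E.State} (h : ¬ E.Terminal s) (Q : E.State → Action → ℝ) :
    E.maxValue Q s = (E.allowed s).sup' (E.allowed_nonempty h) (Q s) := dif_neg h

theorem le_maxValue {s : E.State} (h : ¬ E.Terminal s) (Q : E.State → Action → ℝ) {a : Action}
    (ha : a ∈ E.allowed s) : Q s a ≤ E.maxValue Q s := by
  rw [maxValue_of_not_terminal h]
  exact Finset.le_sup' (Q s) ha

theorem exists_eq_maxValue {s : E.State} (h : ¬ E.Terminal s) (Q : E.State → Action → ℝ) :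
    ∃ a ∈ E.allowed s, E.maxValue Q s = Q s a := by
  rw [maxValue_of_not_terminal h]
  exact Finset.exists_mem_eq_sup' (E.allowed_nonempty h) (Q s)

theorem maxValue_le_add {s : E.State} {Q Q' : E.State → Action → ℝ} {B : ℝ} (hB : 0 ≤ B)
    (h : ¬ E.Terminal s → ∀ a ∈ E.allowed s, |Q s a - Q' s a| ≤ B) :
    E.maxValue Q s ≤ E.maxValue Q' s + B := by
  by_cases hs : E.Terminal s
  · simpa [maxValue_of_terminal hs] using hB
  · obtain ⟨a, ha, hQ⟩ := exists_eq_maxValue hs Q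
    have h1 := (abs_le.1 (h hs a ha)).2
    have h2 := le_maxValue hs Q' ha
    linarith

theorem abs_maxValue_sub_le {s : E.State} {Q Q' : E.State → Action → ℝ} {B : ℝ} (hB : 0 ≤ B)
    (h : ¬ E.Terminal s → ∀ a ∈ E.allowed s, |Q s a - Q' s a| ≤ B) :
    |E.maxValue Q s - E.maxValue Q' s| ≤ B := by
  have h1 := maxValue_le_add hB h
  have h2 := maxValue_le_add (Q := Q') (Q' := Q) hB
    fun hs a ha => by rw [abs_sub_comm]; exact h hs a ha
  rw [abs_le]
  constructor <;> linarith

variable (E) in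
/-- The Bellman optimality operator. It is applied at every pair `(s, a)`, possible or not, as is
the definition of `optimalActionValue`. -/
def bellman (γ : ℝ) (Q : E.State → Action → ℝ) : E.State → Action → ℝ := fun s a =>
  E.reward s a + γ * E.maxValue Q (E.next s a)

theorem exists_bellman_fixedPoint {γ : ℝ} (h0 : 0 ≤ γ) (h1 : γ < 1) :
    ∃ Q, E.bellman γ Q = Q := by
  have hc : ContractingWith ⟨γ, h0⟩ (E.bellman γ) := by
    refine ⟨by exact_mod_cast h1, LipschitzWith.of_dist_le_mul fun Q Q' => ?_⟩
    have hr : 0 ≤ γ * dist Q Q' := mul_nonneg h0 dist_nonneg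
    refine (dist_pi_le_iff hr).2 fun s => (dist_pi_le_iff hr).2 fun a => ?_
    have h : |E.maxValue Q (E.next s a) - E.maxValue Q' (E.next s a)| ≤ dist Q Q' :=
      abs_maxValue_sub_le dist_nonneg fun _ b _ =>
        (dist_le_pi_dist (Q (E.next s a)) (Q' (E.next s a)) b).trans (dist_le_pi_dist Q Q' _)
    rw [Real.dist_eq, bellman, bellman, add_sub_add_left_eq_sub, ← mul_sub, abs_mul,
      abs_of_nonneg h0]
    exact mul_le_mul_of_nonneg_left h h0
  exact ⟨_, hc.fixedPoint_isFixedPt⟩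

theorem follow_of_terminal (π : E.Policy) {s : E.State} (h : E.Terminal s) (n : ℕ) :
    E.follow π s n = s := by
  induction n with
  | zero => rfl
  | succ n ih => rw [follow, ih, if_pos h]

theorem follow_succ' (π : E.Policy) {s : E.State} (h : ¬ E.Terminal s) (n : ℕ) :
    E.follow π s (n + 1) = E.follow π (E.next s (π.1 s)) n := by
  induction n with
  | zero => simp [follow, h]
  | succ n ih => rw [follow, ih, follow]

theorem policyValue_of_terminal (γ : ℝ) (π : E.Policy) {s : E.State} (h : E.Terminal s) :
    E.policyValue γ π s = 0 := by
  simp [policyValue, follow_of_terminal π h, h]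

open Classical in
theorem summable_policyValue {γ : ℝ} (h0 : 0 ≤ γ) (h1 : γ < 1) (π : E.Policy) (s : E.State) :
    Summable fun n : ℕ => γ ^ n * (if E.Terminal (E.follow π s n) then 0
      else E.reward (E.follow π s n) (π.1 (E.follow π s n))) := by
  obtain ⟨R, hR⟩ := (Set.finite_range fun x : E.State × Action => |E.reward x.1 x.2|).bddAbove
  have hR' : ∀ x a, |E.reward x a| ≤ R := fun x a => hR ⟨(x, a), rfl⟩
  refine Summable.of_norm_bounded ((summable_geometric_of_lt_one h0 h1).mul_right R) fun n => ?_
  rw [norm_mul, norm_pow, Real.norm_of_nonneg h0]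
  refine mul_le_mul_of_nonneg_left ?_ (pow_nonneg h0 n)
  split_ifs
  · simpa using (abs_nonneg _).trans (hR' s 0)
  · exact hR' _ _

theorem policyValue_of_not_terminal {γ : ℝ} (h0 : 0 ≤ γ) (h1 : γ < 1) (π : E.Policy)
    {s : E.State} (h : ¬ E.Terminal s) :
    E.policyValue γ π s = E.policyActionValue γ π s (π.1 s) := by
  classical
  rw [policyValue, (summable_policyValue h0 h1 π s).tsum_eq_zero_add, policyActionValue,
    policyValue, ← tsum_mul_left]
  congr 1
  · simp [follow, h]
  · refine tsum_congr fun n => ?_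
    rw [follow_succ' π h, pow_succ', mul_assoc]

/-- A function on a finite set is nonpositive if each value is nonpositive or at most `γ` times
some value. -/
theorem nonpos_of_le_mul {ι : Type*} [Finite ι] {γ : ℝ} (h1 : γ < 1) {f : ι → ℝ}
    (h : ∀ i, f i ≤ 0 ∨ ∃ j, f i ≤ γ * f j) (h0 : 0 ≤ γ) (i : ι) : f i ≤ 0 := by
  have : Nonempty ι := ⟨i⟩
  obtain ⟨m, hm⟩ := Finite.exists_max f
  refine (hm i).trans ?_
  rcases h m with h | ⟨j, hj⟩
  · exact h
  · have := mul_le_mul_of_nonneg_left (hm j) h0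
    by_contra! hpos
    nlinarith

theorem policyValue_le_maxValue {γ : ℝ} (h0 : 0 ≤ γ) (h1 : γ < 1) {Q : E.State → Action → ℝ}
    (hQ : E.bellman γ Q = Q) (π : E.Policy) (s : E.State) :
    E.policyValue γ π s ≤ E.maxValue Q s := by
  refine sub_nonpos.1 (nonpos_of_le_mul (f := fun s => E.policyValue γ π s - E.maxValue Q s) h1
    (fun s => ?_) h0 s)
  by_cases hs : E.Terminal s
  · left
    simp [policyValue_of_terminal γ π hs, maxValue_of_terminal hs]
  · right
    refine ⟨E.next s (π.1 s), ?_⟩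
    have h2 := le_maxValue hs Q (π.2 s hs)
    rw [← congrFun (congrFun hQ s) (π.1 s), bellman] at h2
    simp only [policyValue_of_not_terminal h0 h1 π hs, policyActionValue]
    linarith

theorem exists_policy_maxValue_le {γ : ℝ} (h0 : 0 ≤ γ) (h1 : γ < 1) {Q : E.State → Action → ℝ}
    (hQ : E.bellman γ Q = Q) : ∃ π : E.Policy, ∀ s, E.maxValue Q s ≤ E.policyValue γ π s := by
  have hex : ∀ s, ∃ a, ¬ E.Terminal s → a ∈ E.allowed s ∧ E.maxValue Q s = Q s a := fun s => by
    by_cases hs : E.Terminal s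
    · exact ⟨0, fun h => absurd hs h⟩
    · obtain ⟨a, ha⟩ := exists_eq_maxValue hs Q
      exact ⟨a, fun _ => ha⟩
  choose f hf using hex
  let π : E.Policy := ⟨f, fun s hs => (hf s hs).1⟩
  refine ⟨π, fun s => ?_⟩
  refine sub_nonpos.1 (nonpos_of_le_mul (f := fun s => E.maxValue Q s - E.policyValue γ π s) h1
    (fun s => ?_) h0 s)
  by_cases hs : E.Terminal s
  · left
    simp [policyValue_of_terminal γ π hs, maxValue_of_terminal hs]
  · right
    refine ⟨E.next s (f s), ?_⟩
    have h2 := (hf s hs).2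
    rw [← congrFun (congrFun hQ s) (f s), bellman] at h2
    have h3 : E.policyValue γ π s = E.reward s (f s) + γ * E.policyValue γ π (E.next s (f s)) :=
      policyValue_of_not_terminal h0 h1 π hs
    simp only [h3]
    linarith

theorem optimalActionValue_eq {γ : ℝ} (h0 : 0 ≤ γ) (h1 : γ < 1) {Q : E.State → Action → ℝ}
    (hQ : E.bellman γ Q = Q) : E.optimalActionValue γ = Q := by
  obtain ⟨π₀, hπ₀⟩ := exists_policy_maxValue_le h0 h1 hQ
  have : Nonempty E.Policy := ⟨π₀⟩
  funext s a
  have hle : ∀ π : E.Policy, E.policyActionValue γ π s a ≤ Q s a := fun π => by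
    rw [← congrFun (congrFun hQ s) a, bellman, policyActionValue]
    have := mul_le_mul_of_nonneg_left (policyValue_le_maxValue h0 h1 hQ π (E.next s a)) h0
    linarith
  refine le_antisymm (ciSup_le hle) ?_
  refine le_trans ?_ (le_ciSup (f := fun π : E.Policy => E.policyActionValue γ π s a)
    ⟨Q s a, by rintro _ ⟨π, rfl⟩; exact hle π⟩ π₀)
  rw [← congrFun (congrFun hQ s) a, bellman, policyActionValue]
  have := mul_le_mul_of_nonneg_left (hπ₀ (E.next s a)) h0
  linarith

theorem bellman_optimalActionValue {γ : ℝ} (h0 : 0 ≤ γ) (h1 : γ < 1) :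
    E.bellman γ (E.optimalActionValue γ) = E.optimalActionValue γ := by
  obtain ⟨Q, hQ⟩ := exists_bellman_fixedPoint (E := E) h0 h1
  rw [optimalActionValue_eq h0 h1 hQ, hQ]

end Environment

/-! ### Pathwise invariants of the algorithm -/

variable {E : Environment}

theorem decay_mem_Icc {η lower x₀ x : ℝ} (hη : 0 ≤ η) (hl : 0 < lower)
    (hx : x ∈ Set.Icc (min x₀ (lower * Real.exp (-η))) x₀) :
    decay η lower x ∈ Set.Icc (min x₀ (lower * Real.exp (-η))) x₀ := by
  unfold decay
  split_ifs with h
  · have he : Real.exp (-η) ≤ 1 := Real.exp_le_one_iff.2 (by linarith)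
    refine ⟨(min_le_right _ _).trans (mul_le_mul_of_nonneg_right h (Real.exp_pos _).le), ?_⟩
    exact (mul_le_of_le_one_right (hl.le.trans h) he).trans hx.2
  · exact hx

theorem run_α_mem {p : Params} (hp : p.Valid) (greedy : (Action → ℝ) → Action)
    (Q₀ : E.State → Action → ℝ) (w : ℕ → Noise E) (t : ℕ) :
    (run p greedy Q₀ w t).α ∈ Set.Icc (min p.αmax (p.αmin * Real.exp (-p.η))) p.αmax := by
  induction t with
  | zero => exact ⟨min_le_left _ _, le_rfl⟩
  | succ t ih => exact decay_mem_Icc hp.η_nonneg hp.αmin_pos ih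

theorem run_ε_mem {p : Params} (hp : p.Valid) (greedy : (Action → ℝ) → Action)
    (Q₀ : E.State → Action → ℝ) (w : ℕ → Noise E) (t : ℕ) :
    (run p greedy Q₀ w t).ε ∈ Set.Icc (min p.εmax (p.εmin * Real.exp (-p.η))) p.εmax := by
  induction t with
  | zero => exact ⟨min_le_left _ _, le_rfl⟩
  | succ t ih => exact decay_mem_Icc hp.η_nonneg hp.εmin_pos ih

theorem firstAllowed_mem {s : E.State} (h : ¬ E.Terminal s) (σ : Equiv.Perm Action) :
    firstAllowed s σ ∈ E.allowed s := by
  unfold firstAllowed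
  cases hf : (List.ofFn σ).find? fun a => decide (a ∈ E.allowed s) with
  | none =>
    obtain ⟨a, ha⟩ := E.allowed_nonempty h
    rw [List.find?_eq_none] at hf
    exact absurd (decide_eq_true ha) (hf a ((List.mem_ofFn' _ _).2 ⟨σ.symm a, by simp⟩))
  | some b => simpa using List.find?_some hf

theorem firstAllowed_eq {s : E.State} {a : Action} (ha : a ∈ E.allowed s) {σ : Equiv.Perm Action}
    (hσ : σ 0 = a) : firstAllowed s σ = a := by
  unfold firstAllowed
  rw [List.ofFn_succ, List.find?_cons_of_pos (by simpa [hσ] using ha)]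
  exact hσ

theorem chosenAction_mem (p : Params) (greedy : (Action → ℝ) → Action) {c : Config E}
    (h : ¬ E.Terminal c.state) (w : Noise E) : chosenAction p greedy c w ∈ E.allowed c.state := by
  unfold chosenAction
  split_ifs with h1 h2
  · exact firstAllowed_mem h _
  · exact h2
  · exact firstAllowed_mem h _

/-- The states in which the algorithm acts: visitable and not terminal. -/
def Active (start : PMF E.State) (s : E.State) : Prop := Visitable start s ∧ ¬ E.Terminal s

theorem Visitable.next {start : PMF E.State} {s : E.State} (h : Active start s) {a : Action}
    (ha : a ∈ E.allowed s) : Visitable start (E.next s a) := by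
  obtain ⟨⟨s₀, h0, hs⟩, ht⟩ := h
  exact ⟨s₀, h0, hs.tail ⟨ht, a, ha, rfl⟩⟩

theorem active_of_mem_support {start : PMF E.State}
    (hstart : ∀ s ∈ start.support, ¬ E.Terminal s) {s : E.State} (hs : s ∈ start.support) :
    Active start s := ⟨⟨s, hs, .refl⟩, hstart s hs⟩

theorem active_run {start : PMF E.State} (hstart : ∀ s ∈ start.support, ¬ E.Terminal s)
    (p : Params) (greedy : (Action → ℝ) → Action) (Q₀ : E.State → Action → ℝ) {w : ℕ → Noise E}
    (hw : ∀ t, (w t).2.2 ∈ start.support) (t : ℕ) :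
    Active start (run p greedy Q₀ w t).state := by
  induction t with
  | zero => exact active_of_mem_support hstart (hw 0)
  | succ t ih =>
    simp only [run, stepConfig]
    split_ifs with h
    · exact active_of_mem_support hstart (hw _)
    · exact ⟨.next ih (chosenAction_mem p greedy ih.2 _), h⟩

/-! ### Convergence along a path -/

/-- A sequence that never increases except towards `c`, and that is infinitely often contracted
towards `c` by a factor bounded away from one, eventually drops below `c + δ`. -/
theorem eventually_le_of_frequently_update {e : ℕ → ℝ} {U : ℕ → Prop} {α₀ c δ : ℝ} {T : ℕ}
    (hα₀ : 0 < α₀) (hstay : ∀ t ≥ T, ¬ U t → e (t + 1) ≤ e t)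
    (hupd : ∀ t ≥ T, U t → ∃ α ∈ Set.Icc α₀ 1, e (t + 1) ≤ (1 - α) * e t + α * c)
    (hU : ∃ᶠ t in atTop, U t) (hδ : 0 < δ) : ∀ᶠ t in atTop, e t ≤ c + δ := by
  let y : ℕ → ℝ := fun t => max (e t - c) 0
  have hy0 : ∀ t, 0 ≤ y t := fun t => le_max_right _ _
  have hα₁ : α₀ ≤ 1 := by
    obtain ⟨t, ht, hUt⟩ := (frequently_atTop.1 hU) T
    obtain ⟨α, hα, -⟩ := hupd t ht hUt
    exact hα.1.trans hα.2
  have hcontr : ∀ t ≥ T, U t → y (t + 1) ≤ (1 - α₀) * y t := fun t ht hUt => by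
    obtain ⟨α, hα, he⟩ := hupd t ht hUt
    have h1 : e t - c ≤ y t := le_max_left _ _
    refine max_le ?_ (mul_nonneg (by linarith) (hy0 t))
    have h2 := mul_le_mul_of_nonneg_left h1 (sub_nonneg.2 hα.2)
    have h3 := mul_le_mul_of_nonneg_right hα.1 (hy0 t)
    linarith
  have hmono : ∀ t ≥ T, y (t + 1) ≤ y t := fun t ht => by
    by_cases hUt : U t
    · have := hcontr t ht hUt
      have := mul_nonneg hα₀.le (hy0 t)
      linarith
    · exact max_le_max_right 0 (sub_le_sub_right (hstay t ht hUt) c)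
  have hanti : ∀ s ≥ T, ∀ t ≥ s, y t ≤ y s := fun s hs t hst => by
    induction t, hst using Nat.le_induction with
    | base => exact le_rfl
    | succ t hst ih => exact (hmono t (hs.trans hst)).trans ih
  have hpow : ∀ n : ℕ, ∃ t ≥ T, y t ≤ (1 - α₀) ^ n * y T := fun n => by
    induction n with
    | zero => exact ⟨T, le_rfl, by simp⟩
    | succ n ih =>
      obtain ⟨s, hs, hys⟩ := ih
      obtain ⟨t, hst, hUt⟩ := (frequently_atTop.1 hU) s
      refine ⟨t + 1, by omega, ?_⟩
      have h1 : y t ≤ (1 - α₀) ^ n * y T := (hanti s hs t hst).trans hys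
      calc y (t + 1) ≤ (1 - α₀) * y t := hcontr t (hs.trans hst) hUt
        _ ≤ (1 - α₀) * ((1 - α₀) ^ n * y T) := mul_le_mul_of_nonneg_left h1 (by linarith)
        _ = (1 - α₀) ^ (n + 1) * y T := by ring
  have hlim : Tendsto (fun n : ℕ => (1 - α₀) ^ n * y T) atTop (𝓝 0) := by
    simpa using (tendsto_pow_atTop_nhds_zero_of_lt_one (by linarith : 0 ≤ 1 - α₀)
      (by linarith)).mul_const (y T)
  obtain ⟨n, hn⟩ := (hlim.eventually (gt_mem_nhds hδ)).exists
  obtain ⟨s, hs, hys⟩ := hpow n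
  filter_upwards [eventually_ge_atTop s] with t hst
  have h1 : e t - c ≤ y t := le_max_left _ _
  have h2 := hanti s hs t hst
  linarith

theorem table_succ_of_not_updated {p : Params} {greedy : (Action → ℝ) → Action}
    {Q₀ : E.State → Action → ℝ} {w : ℕ → Noise E} {s : E.State} {a : Action} {t : ℕ}
    (h : ¬ Updated p greedy Q₀ w s a t) :
    (run p greedy Q₀ w (t + 1)).table s a = (run p greedy Q₀ w t).table s a := by
  refine if_neg fun h' => h ⟨h'.1.symm, h'.2.symm⟩

theorem table_succ_of_updated {p : Params} {greedy : (Action → ℝ) → Action}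
    {Q₀ : E.State → Action → ℝ} {w : ℕ → Noise E} {s : E.State} {a : Action} {t : ℕ}
    (h : Updated p greedy Q₀ w s a t) :
    (run p greedy Q₀ w (t + 1)).table s a =
      (1 - (run p greedy Q₀ w (t + 1)).α) * (run p greedy Q₀ w t).table s a +
        (run p greedy Q₀ w (t + 1)).α * E.bellman p.γ (run p greedy Q₀ w t).table s a := by
  obtain ⟨rfl, rfl⟩ := h
  exact if_pos ⟨rfl, rfl⟩

/-- An update contracts the error of an entry towards `γ B`, if `B` bounds the error of all
entries. -/
theorem abs_table_succ_sub_le {start : PMF E.State} {p : Params} (hp : p.Valid)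
    {greedy : (Action → ℝ) → Action} {Q₀ : E.State → Action → ℝ} {w : ℕ → Noise E} {B : ℝ}
    (hB : 0 ≤ B) {t : ℕ}
    (hbd : ∀ s a, IsEntry start s a →
      |(run p greedy Q₀ w t).table s a - E.optimalActionValue p.γ s a| ≤ B)
    {s : E.State} {a : Action} (hsa : IsEntry start s a) (h : Updated p greedy Q₀ w s a t) :
    |(run p greedy Q₀ w (t + 1)).table s a - E.optimalActionValue p.γ s a| ≤
      (1 - (run p greedy Q₀ w (t + 1)).α) *
        |(run p greedy Q₀ w t).table s a - E.optimalActionValue p.γ s a| +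
      (run p greedy Q₀ w (t + 1)).α * (p.γ * B) := by
  have hα := run_α_mem hp greedy Q₀ w (t + 1)
  have hα0 : 0 ≤ (run p greedy Q₀ w (t + 1)).α :=
    (le_min hp.αmax_pos.le (mul_pos hp.αmin_pos (Real.exp_pos _)).le).trans hα.1
  have hα1 : 0 ≤ 1 - (run p greedy Q₀ w (t + 1)).α := sub_nonneg.2 (hα.2.trans hp.αmax_le_one)
  have hbell : |E.bellman p.γ (run p greedy Q₀ w t).table s a -
      E.optimalActionValue p.γ s a| ≤ p.γ * B := by
    rw [← congrFun (congrFun (Environment.bellman_optimalActionValue hp.γ_nonneg hp.γ_lt_one) s) a,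
      Environment.bellman, Environment.bellman, add_sub_add_left_eq_sub, ← mul_sub, abs_mul,
      abs_of_nonneg hp.γ_nonneg]
    exact mul_le_mul_of_nonneg_left (Environment.abs_maxValue_sub_le hB fun hs b hb =>
      hbd _ b ⟨.next ⟨hsa.1, hsa.2.1⟩ hsa.2.2, hs, hb⟩) hp.γ_nonneg
  rw [table_succ_of_updated h]
  generalize (run p greedy Q₀ w (t + 1)).α = α at *
  generalize E.bellman p.γ (run p greedy Q₀ w t).table s a = b at *
  generalize (run p greedy Q₀ w t).table s a = x
  generalize E.optimalActionValue p.γ s a = q at *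
  calc |(1 - α) * x + α * b - q| = |(1 - α) * (x - q) + α * (b - q)| := by ring_nf
    _ ≤ |(1 - α) * (x - q)| + |α * (b - q)| := abs_add_le _ _
    _ = (1 - α) * |x - q| + α * |b - q| := by
      rw [abs_mul, abs_mul, abs_of_nonneg hα0, abs_of_nonneg hα1]
    _ ≤ _ := by gcongr

/-- A common bound on the errors of all entries persists. -/
theorem abs_table_sub_le_of_le {start : PMF E.State} {p : Params} (hp : p.Valid)
    {greedy : (Action → ℝ) → Action} {Q₀ : E.State → Action → ℝ} {w : ℕ → Noise E} {B : ℝ}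
    (hB : 0 ≤ B) {T : ℕ}
    (hbd : ∀ s a, IsEntry start s a →
      |(run p greedy Q₀ w T).table s a - E.optimalActionValue p.γ s a| ≤ B)
    {t : ℕ} (hT : T ≤ t) : ∀ s a, IsEntry start s a →
      |(run p greedy Q₀ w t).table s a - E.optimalActionValue p.γ s a| ≤ B := by
  induction t, hT using Nat.le_induction with
  | base => exact hbd
  | succ t hT ih =>
    intro s a hsa
    by_cases h : Updated p greedy Q₀ w s a t
    · have hα := run_α_mem hp greedy Q₀ w (t + 1)
      have hα0 : 0 ≤ (run p greedy Q₀ w (t + 1)).α :=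
        (le_min hp.αmax_pos.le (mul_pos hp.αmin_pos (Real.exp_pos _)).le).trans hα.1
      have hα1 := sub_nonneg.2 (hα.2.trans hp.αmax_le_one)
      have h1 := abs_table_succ_sub_le hp hB ih hsa h
      have h2 := mul_le_mul_of_nonneg_left (ih s a hsa) hα1
      have h3 := mul_le_mul_of_nonneg_left (mul_le_of_le_one_left hB hp.γ_lt_one.le) hα0
      linarith
    · rw [table_succ_of_not_updated h]
      exact ih s a hsa

theorem tendsto_table {start : PMF E.State} {p : Params} (hp : p.Valid)
    {greedy : (Action → ℝ) → Action} {Q₀ : E.State → Action → ℝ} {w : ℕ → Noise E}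
    (hU : ∀ s a, IsEntry start s a → ∃ᶠ t in atTop, Updated p greedy Q₀ w s a t)
    {s : E.State} {a : Action} (hsa : IsEntry start s a) :
    Tendsto (fun t => (run p greedy Q₀ w t).table s a) atTop
      (𝓝 (E.optimalActionValue p.γ s a)) := by
  let err : ℕ → E.State → Action → ℝ := fun t s a =>
    |(run p greedy Q₀ w t).table s a - E.optimalActionValue p.γ s a|
  obtain ⟨B, hB⟩ := (Set.finite_range fun x : E.State × Action => err 0 x.1 x.2).bddAbove
  -- The bound is enlarged to be positive, so that `(1 - γ) / 2 * B` is a positive margin.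
  have hB₀ : 0 < max B 1 := lt_max_of_lt_right one_pos
  let κ : ℝ := (1 + p.γ) / 2
  have hκ0 : 0 < κ := by have := hp.γ_nonneg; simp only [κ]; linarith
  have hκ1 : κ < 1 := by have := hp.γ_lt_one; simp only [κ]; linarith
  have hα₀ : 0 < min p.αmax (p.αmin * Real.exp (-p.η)) :=
    lt_min hp.αmax_pos (mul_pos hp.αmin_pos (Real.exp_pos _))
  have hpow : ∀ n : ℕ, ∃ T, ∀ t ≥ T, ∀ s a, IsEntry start s a →
      err t s a ≤ κ ^ n * max B 1 := fun n => by
    induction n with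
    | zero =>
      refine ⟨0, fun t ht => abs_table_sub_le_of_le hp (by simp) (T := 0) (fun s a _ => ?_) ht⟩
      rw [pow_zero, one_mul]
      exact (hB ⟨(s, a), rfl⟩).trans (le_max_left _ _)
    | succ n ih =>
      obtain ⟨T, hT⟩ := ih
      have hBn : 0 < κ ^ n * max B 1 := mul_pos (pow_pos hκ0 n) hB₀
      have hev : ∀ᶠ t in atTop, ∀ s a, IsEntry start s a → err t s a ≤ κ ^ (n + 1) * max B 1 := by
        refine eventually_all.2 fun s => eventually_all.2 fun a => ?_
        by_cases hsa : IsEntry start s a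
        · have hδ : 0 < (1 - p.γ) / 2 * (κ ^ n * max B 1) :=
            mul_pos (by have := hp.γ_lt_one; linarith) hBn
          have key := eventually_le_of_frequently_update (e := fun t => err t s a)
            (U := Updated p greedy Q₀ w s a) (c := p.γ * (κ ^ n * max B 1)) (T := T) hα₀
            (fun t _ hn => by simp only [err]; rw [table_succ_of_not_updated hn])
            (fun t ht hu => ⟨_, ⟨(run_α_mem hp greedy Q₀ w (t + 1)).1,
              (run_α_mem hp greedy Q₀ w (t + 1)).2.trans hp.αmax_le_one⟩,
              abs_table_succ_sub_le hp hBn.le (hT t ht) hsa hu⟩) (hU s a hsa) hδ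
          filter_upwards [key] with t ht _
          refine ht.trans_eq ?_
          simp only [κ]
          ring
        · exact Eventually.of_forall fun t h => absurd h hsa
      exact eventually_atTop.1 hev
  have hlim : Tendsto (fun n : ℕ => κ ^ n * max B 1) atTop (𝓝 0) := by
    simpa using (tendsto_pow_atTop_nhds_zero_of_lt_one hκ0.le hκ1).mul_const (max B 1)
  rw [Metric.tendsto_atTop]
  intro δ hδ
  obtain ⟨n, hn⟩ := (hlim.eventually (gt_mem_nhds hδ)).exists
  obtain ⟨T, hT⟩ := hpow n
  exact ⟨T, fun t ht => (hT t ht s a hsa).trans_lt hn⟩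

/-! ### A word of action orders that forces an update -/

open Classical in
/-- The next state of an exploring step, if the actions are drawn in the order `σ` and a new
episode would start from `s₀`. -/
def exploreStep (s₀ x : E.State) (σ : Equiv.Perm Action) : E.State :=
  if E.Terminal (E.next x (firstAllowed x σ)) then s₀ else E.next x (firstAllowed x σ)

/-- Exploring from `x` with the given list of action orders, and restarting from `s₀`, takes the
action `a` in the state `s` at some time. -/
def Hits (s₀ s : E.State) (a : Action) : E.State → List (Equiv.Perm Action) → Prop
  | _, [] => False
  | x, σ :: l => (x = s ∧ firstAllowed x σ = a) ∨ Hits s₀ s a (exploreStep s₀ x σ) l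

theorem hits_append {s₀ s : E.State} {a : Action} (l l' : List (Equiv.Perm Action))
    (x : E.State) : Hits s₀ s a x (l ++ l') ↔
      Hits s₀ s a x l ∨ Hits s₀ s a (l.foldl (exploreStep s₀) x) l' := by
  induction l generalizing x with
  | nil => simp [Hits]
  | cons σ l ih => simp [Hits, ih, or_assoc]

theorem active_exploreStep {start : PMF E.State} (hstart : ∀ s ∈ start.support, ¬ E.Terminal s)
    {s₀ : E.State} (h0 : s₀ ∈ start.support) {x : E.State} (hx : Active start x)
    (σ : Equiv.Perm Action) : Active start (exploreStep s₀ x σ) := by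
  unfold exploreStep
  split_ifs with h
  · exact active_of_mem_support hstart h0
  · exact ⟨.next hx (firstAllowed_mem hx.2 σ), h⟩

theorem active_foldl_exploreStep {start : PMF E.State}
    (hstart : ∀ s ∈ start.support, ¬ E.Terminal s) {s₀ : E.State} (h0 : s₀ ∈ start.support)
    (l : List (Equiv.Perm Action)) {x : E.State} (hx : Active start x) :
    Active start (l.foldl (exploreStep s₀) x) := by
  induction l generalizing x with
  | nil => exact hx
  | cons σ l ih => exact ih (active_exploreStep hstart h0 hx σ)

theorem exists_hits_of_reachable {s₀ s : E.State} {a : Action} (hs : ¬ E.Terminal s)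
    (ha : a ∈ E.allowed s) {x : E.State} (h : Relation.ReflTransGen E.Move x s) :
    ∃ l, Hits s₀ s a x l := by
  induction h using Relation.ReflTransGen.head_induction_on with
  | refl => exact ⟨[Equiv.swap 0 a], Or.inl ⟨rfl, firstAllowed_eq ha (by simp)⟩⟩
  | @head x y hxy hys ih =>
    obtain ⟨-, b, hb, rfl⟩ := hxy
    obtain ⟨l, hl⟩ := ih
    have hnt : ¬ E.Terminal (E.next x b) := by
      rcases hys.cases_head with h | ⟨z, hz, -⟩
      · rwa [h]
      · exact hz.1
    refine ⟨Equiv.swap 0 b :: l, Or.inr ?_⟩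
    rwa [exploreStep, firstAllowed_eq hb (by simp), if_neg hnt]

theorem exists_hits_of_reachable_terminal {s₀ s : E.State} {a : Action}
    (h0 : ∃ l, Hits s₀ s a s₀ l) {x z : E.State} (hz : E.Terminal z)
    (h : Relation.ReflTransGen E.Move x z) (hx : ¬ E.Terminal x) : ∃ l, Hits s₀ s a x l := by
  induction h using Relation.ReflTransGen.head_induction_on with
  | refl => exact absurd hz hx
  | @head x y hxy _ ih =>
    obtain ⟨-, b, hb, rfl⟩ := hxy
    by_cases hnt : E.Terminal (E.next x b)
    · obtain ⟨l, hl⟩ := h0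
      refine ⟨Equiv.swap 0 b :: l, Or.inr ?_⟩
      rwa [exploreStep, firstAllowed_eq hb (by simp), if_pos hnt]
    · obtain ⟨l, hl⟩ := ih hnt
      refine ⟨Equiv.swap 0 b :: l, Or.inr ?_⟩
      rwa [exploreStep, firstAllowed_eq hb (by simp), if_neg hnt]

/-- One word of action orders forces the action `a` to be taken in the state `s`, whatever the
active state from which the exploration starts. -/
theorem exists_universal_word {start : PMF E.State}
    (hstart : ∀ s ∈ start.support, ¬ E.Terminal s)
    (hreach : ∀ s, Visitable start s → ∃ s', E.Terminal s' ∧ Relation.ReflTransGen E.Move s s')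
    {s : E.State} {a : Action} (hsa : IsEntry start s a) :
    ∃ s₀ ∈ start.support, ∃ l, ∀ x, Active start x → Hits s₀ s a x l := by
  classical
  obtain ⟨⟨s₀, h0, hpath⟩, hs, ha⟩ := hsa
  have hone : ∀ x, Active start x → ∃ l, Hits s₀ s a x l := fun x hx => by
    obtain ⟨z, hz, hxz⟩ := hreach x hx.1
    exact exists_hits_of_reachable_terminal (exists_hits_of_reachable hs ha hpath) hz hxz hx.2
  have hfin : ∀ F : Finset E.State, ∃ l, ∀ x ∈ F, Active start x → Hits s₀ s a x l := fun F => by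
    induction F using Finset.induction_on with
    | empty => exact ⟨[], by simp⟩
    | insert y F _ ih =>
      obtain ⟨l, hl⟩ := ih
      by_cases hy : Active start y
      · obtain ⟨l', hl'⟩ := hone _ (active_foldl_exploreStep hstart h0 l hy)
        refine ⟨l ++ l', fun x hx hxa => (hits_append l l' x).2 ?_⟩
        rcases Finset.mem_insert.1 hx with rfl | hx
        · exact Or.inr hl'
        · exact Or.inl (hl x hx hxa)
      · refine ⟨l, fun x hx hxa => ?_⟩
        rcases Finset.mem_insert.1 hx with rfl | hx
        · exact absurd hxa hy
        · exact hl x hx hxa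
  obtain ⟨l, hl⟩ := hfin Finset.univ
  exact ⟨s₀, h0, l, fun x => hl x (Finset.mem_univ x)⟩

/-- If the noise after time `t` explores, restarts from `s₀` and draws the actions in the orders
given by `l`, then an update that `l` forces does occur. -/
theorem exists_updated_of_hits {p : Params} (hp : p.Valid) {greedy : (Action → ℝ) → Action}
    {Q₀ : E.State → Action → ℝ} {w : ℕ → Noise E} {s₀ s : E.State} {a : Action}
    (l : List (Equiv.Perm Action)) {t : ℕ}
    (hw : ∀ i (hi : i < l.length),
      (w (t + i + 1)).1 < min p.εmax (p.εmin * Real.exp (-p.η)) ∧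
      (w (t + i + 1)).2.1 = l[i] ∧ (w (t + i + 1)).2.2 = s₀)
    (h : Hits s₀ s a (run p greedy Q₀ w t).state l) :
    ∃ t' ≥ t, Updated p greedy Q₀ w s a t' := by
  induction l generalizing t with
  | nil => exact h.elim
  | cons σ l ih =>
    obtain ⟨hu, hσ, hr⟩ := hw 0 (by simp)
    simp only [add_zero, List.getElem_cons_zero] at hu hσ hr
    have hact : chosenAction p greedy (run p greedy Q₀ w t) (w (t + 1)) =
        firstAllowed (run p greedy Q₀ w t).state σ := by
      have hε : (w (t + 1)).1 < decay p.η p.εmin (run p greedy Q₀ w t).ε :=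
        hu.trans_le (run_ε_mem hp greedy Q₀ w (t + 1)).1
      rw [chosenAction, if_pos hε, hσ]
    rcases h with ⟨hx, ha⟩ | h
    · exact ⟨t, le_rfl, hx, hact.trans ha⟩
    · have hst : (run p greedy Q₀ w (t + 1)).state =
          exploreStep s₀ (run p greedy Q₀ w t).state σ := by
        rw [run, stepConfig, hact, hr, exploreStep]
      obtain ⟨t', ht', hU⟩ := ih (t := t + 1) (fun i hi => by
        have := hw (i + 1) (by simpa using hi)
        rwa [show t + (i + 1) + 1 = t + 1 + i + 1 by ring] at this) (by rwa [hst])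
      exact ⟨t', by omega, hU⟩

/-! ### Recurrence of words in independent noise -/

/-- A finite pattern of events of positive probability occurs infinitely often, in disjoint
blocks, in a sequence of independent identically distributed variables. -/
theorem ae_frequently_block {Ω X : Type*} [MeasurableSpace Ω] [MeasurableSpace X]
    {P : Measure Ω} [IsProbabilityMeasure P] {ξ : ℕ → Ω → X} (hmeas : ∀ t, Measurable (ξ t))
    (hindep : iIndepFun ξ P) {ν : Measure X} (hlaw : ∀ t, P.map (ξ t) = ν) {N : ℕ}
    {S : Fin N → Set X} (hS : ∀ i, MeasurableSet (S i)) (hpos : ∀ i, ν (S i) ≠ 0) :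
    ∀ᵐ ω ∂P, ∃ᶠ k in atTop, ∀ i : Fin N, ξ (k * N + i + 1) ω ∈ S i := by
  let g : ℕ × Fin N → ℕ := fun x => x.1 * N + x.2 + 1
  have hg : Function.Injective g := by
    rintro ⟨k, i⟩ ⟨k', i'⟩ h
    simp only [g, add_left_inj] at h
    have hN : 0 < N := i.pos
    have hmod : (i : ℕ) = i' := by
      have := congrArg (· % N) h
      simpa [Nat.mul_add_mod', Nat.mod_eq_of_lt i.2, Nat.mod_eq_of_lt i'.2] using this
    have hk : k = k' := by
      rw [hmod, add_left_inj] at h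
      exact Nat.eq_of_mul_eq_mul_right hN h
    exact Prod.ext hk (Fin.ext hmod)
  have hind := hindep.precomp hg
  let A : ℕ → Set Ω := fun k => ⋂ i : Fin N, ξ (g (k, i)) ⁻¹' S i
  have hA : ∀ k, MeasurableSet (A k) := fun k => .iInter fun i => hmeas _ (hS i)
  have hprod : ∀ F : Finset ℕ, P (⋂ k ∈ F, A k) = ∏ _k ∈ F, ∏ i, ν (S i) := fun F => by
    have := hind.measure_inter_preimage_eq_mul (F ×ˢ Finset.univ) (sets := fun x => S x.2)
      fun x _ => hS x.2
    rw [Finset.prod_product] at this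
    calc P (⋂ k ∈ F, A k) = P (⋂ x ∈ F ×ˢ (Finset.univ : Finset (Fin N)), ξ (g x) ⁻¹' S x.2) := by
          congr 1
          ext ω
          simp only [A, Set.mem_iInter, Set.mem_preimage, Finset.mem_product, Finset.mem_univ,
            and_true, Prod.forall]
          exact ⟨fun h k i hk => h k hk i, fun h k hk i => h k i hk⟩
      _ = _ := this
      _ = _ := by
          refine Finset.prod_congr rfl fun k _ => Finset.prod_congr rfl fun i _ => ?_
          rw [← hlaw (g (k, i)), Measure.map_apply (hmeas _) (hS i)]
  have hsingle : ∀ k, P (A k) = ∏ i, ν (S i) := fun k => by simpa using hprod {k}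
  have hAind : iIndepSet A P := (iIndepSet_iff_meas_biInter hA).2 fun F => by
    rw [hprod F]
    exact Finset.prod_congr rfl fun k _ => (hsingle k).symm
  have hsum : ∑' k, P (A k) = ⊤ := by
    simp only [hsingle]
    exact ENNReal.tsum_const_eq_top_of_ne_zero (Finset.prod_ne_zero_iff.2 fun i _ => hpos i)
  have hlim := measure_limsup_eq_one hA hAind hsum
  have hae : ∀ᵐ ω ∂P, ω ∈ limsup A atTop :=
    (prob_compl_eq_zero_iff (MeasurableSet.measurableSet_limsup hA)).2 hlim
  filter_upwards [hae] with ω hω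
  rw [mem_limsup_iff_frequently_mem] at hω
  simpa [A] using hω

theorem noiseLaw_pattern_ne_zero {start : PMF E.State} {s₀ : E.State} (h0 : s₀ ∈ start.support)
    {ε₀ : ℝ} (hε : 0 < ε₀) (σ : Equiv.Perm Action) :
    noiseLaw E start (Set.Iio ε₀ ×ˢ {σ} ×ˢ {s₀}) ≠ 0 := by
  have h1 : (volume.restrict (Set.Icc (0 : ℝ) 1)) (Set.Iio ε₀) ≠ 0 := by
    rw [Measure.restrict_apply measurableSet_Iio]
    refine ne_of_gt (lt_of_lt_of_le ?_ (measure_mono (s := Set.Ioo 0 (min ε₀ 1)) ?_))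
    · simp [hε]
    · intro x hx
      have := lt_min_iff.1 hx.2
      exact ⟨this.1, hx.1.le, this.2.le⟩
  have : MeasurableSingletonClass (Equiv.Perm Action) := ⟨fun _ => trivial⟩
  rw [noiseLaw, Measure.prod_prod, Measure.prod_prod,
    PMF.toMeasure_apply_singleton _ _ (MeasurableSet.singleton _),
    PMF.toMeasure_apply_singleton _ _ (MeasurableSet.singleton _)]
  refine mul_ne_zero h1 (mul_ne_zero ?_ ((PMF.mem_support_iff _ _).1 h0))
  exact (PMF.mem_support_iff _ _).1 (by simp)

theorem ae_restart_mem_support {start : PMF E.State} {Ω : Type*} [MeasurableSpace Ω]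
    {P : Measure Ω} {ξ : ℕ → Ω → Noise E} (hmeas : ∀ t, Measurable (ξ t))
    (hlaw : ∀ t, P.map (ξ t) = noiseLaw E start) :
    ∀ᵐ ω ∂P, ∀ t, (ξ t ω).2.2 ∈ start.support := by
  refine ae_all_iff.2 fun t => ?_
  have hms : MeasurableSet (Set.univ ×ˢ Set.univ ×ˢ start.supportᶜ : Set (Noise E)) :=
    MeasurableSet.univ.prod (MeasurableSet.univ.prod (Set.toFinite _).measurableSet)
  have h : P.map (ξ t) (Set.univ ×ˢ Set.univ ×ˢ start.supportᶜ) = 0 := by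
    rw [hlaw t, noiseLaw, Measure.prod_prod, Measure.prod_prod,
      (PMF.toMeasure_apply_eq_zero_iff _ (Set.toFinite _).measurableSet).2
        disjoint_compl_right, mul_zero, mul_zero]
  rw [Measure.map_apply (hmeas t) hms] at h
  refine measure_mono_null (fun ω hω => ?_) h
  exact ⟨trivial, trivial, hω⟩

theorem ae_frequently_updated {p : Params} (hp : p.Valid) {start : PMF E.State}
    (hstart : ∀ s ∈ start.support, ¬ E.Terminal s) (greedy : (Action → ℝ) → Action)
    (Q₀ : E.State → Action → ℝ) {Ω : Type*} [MeasurableSpace Ω] {P : Measure Ω}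
    [IsProbabilityMeasure P] {ξ : ℕ → Ω → Noise E} (hmeas : ∀ t, Measurable (ξ t))
    (hindep : iIndepFun ξ P) (hlaw : ∀ t, P.map (ξ t) = noiseLaw E start)
    (hreach : ∀ s, Visitable start s → ∃ s', E.Terminal s' ∧ Relation.ReflTransGen E.Move s s')
    {s : E.State} {a : Action} (hsa : IsEntry start s a) :
    ∀ᵐ ω ∂P, ∃ᶠ t in atTop, Updated p greedy Q₀ (fun n => ξ n ω) s a t := by
  obtain ⟨s₀, h0, l, hl⟩ := exists_universal_word hstart hreach hsa
  have hε : 0 < min p.εmax (p.εmin * Real.exp (-p.η)) :=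
    lt_min hp.εmax_pos (mul_pos hp.εmin_pos (Real.exp_pos _))
  have : MeasurableSingletonClass (Equiv.Perm Action) := ⟨fun _ => trivial⟩
  have hblock := ae_frequently_block hmeas hindep hlaw
    (S := fun i : Fin l.length =>
      Set.Iio (min p.εmax (p.εmin * Real.exp (-p.η))) ×ˢ {l[i]} ×ˢ {s₀})
    (fun i => measurableSet_Iio.prod ((MeasurableSet.singleton _).prod (MeasurableSet.singleton _)))
    (fun i => noiseLaw_pattern_ne_zero h0 hε _)
  have hlen : 0 < l.length := List.length_pos_iff.2 fun h => by
    have := hl s ⟨hsa.1, hsa.2.1⟩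
    rw [h] at this
    exact this
  filter_upwards [hblock, ae_restart_mem_support hmeas hlaw] with ω hω hsupp
  refine frequently_atTop.2 fun T => ?_
  obtain ⟨k, hk, hpat⟩ := frequently_atTop.1 hω T
  obtain ⟨t, ht, hU⟩ := exists_updated_of_hits hp (greedy := greedy) (Q₀ := Q₀)
    (w := fun n => ξ n ω) l (t := k * l.length)
    (fun i hi => hpat ⟨i, hi⟩) (hl _ (active_run hstart p greedy Q₀ hsupp _))
  exact ⟨t, (hk.trans (Nat.le_mul_of_pos_right k hlen)).trans ht, hU⟩

end RSSNav

end

/-! ### Convergence of the learning algorithm -/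

theorem mainTheorem2 (E : RSSNav.Environment) (p : RSSNav.Params) (hp : p.Valid)
    (start : PMF E.State) (hstart : ∀ s ∈ start.support, ¬ E.Terminal s)
    (greedy : (RSSNav.Action → ℝ) → RSSNav.Action)
    (hgreedy : ∀ (q : RSSNav.Action → ℝ) (b : RSSNav.Action), q b ≤ q (greedy q))
    (Q₀ : E.State → RSSNav.Action → ℝ)
    {Ω : Type*} [MeasurableSpace Ω] (P : Measure Ω) [IsProbabilityMeasure P]
    (ξ : ℕ → Ω → RSSNav.Noise E) (hmeas : ∀ t, Measurable (ξ t))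
    (hindep : iIndepFun ξ P) (hlaw : ∀ t, P.map (ξ t) = RSSNav.noiseLaw E start) :
    -- convergence whenever every entry is updated infinitely often
    (∀ᵐ ω ∂P,
      (∀ s a, RSSNav.IsEntry start s a →
        ∃ᶠ t in atTop, RSSNav.Updated p greedy Q₀ (fun n => ξ n ω) s a t) →
      ∀ s a, RSSNav.IsEntry start s a →
        Tendsto (fun t => (RSSNav.run p greedy Q₀ (fun n => ξ n ω) t).table s a) atTop
          (𝓝 (E.optimalActionValue p.γ s a))) ∧
    -- every entry is updated infinitely often if the source can always be found
    ((∀ s, RSSNav.Visitable start s → ∃ s', E.Terminal s' ∧ Relation.ReflTransGen E.Move s s') →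
      ∀ᵐ ω ∂P, ∀ s a, RSSNav.IsEntry start s a →
        (∃ᶠ t in atTop, RSSNav.Updated p greedy Q₀ (fun n => ξ n ω) s a t) ∧
        Tendsto (fun t => (RSSNav.run p greedy Q₀ (fun n => ξ n ω) t).table s a) atTop
          (𝓝 (E.optimalActionValue p.γ s a))) := by
  refine ⟨Eventually.of_forall fun ω hU s a hsa => RSSNav.tendsto_table hp hU hsa, fun hreach => ?_⟩
  have hU : ∀ᵐ ω ∂P, ∀ s a, RSSNav.IsEntry start s a →
      ∃ᶠ t in atTop, RSSNav.Updated p greedy Q₀ (fun n => ξ n ω) s a t := by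
    refine ae_all_iff.2 fun s => ae_all_iff.2 fun a => ?_
    by_cases hsa : RSSNav.IsEntry start s a
    · filter_upwards [RSSNav.ae_frequently_updated hp hstart greedy Q₀ hmeas hindep hlaw hreach
        hsa] with ω hω _
      exact hω
    · exact Eventually.of_forall fun ω h => absurd h hsa
  filter_upwards [hU] with ω hω s a hsa
  exact ⟨hω s a hsa, RSSNav.tendsto_table hp hω hsa⟩
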